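/- Let $\mathcal H=(\mathbb C^2)^{\otimes N}$ be the Hilbert space of $N$ qubits, $d=2^N$, and let the qubits be split into two complementary sets $A$ and $B$ of sizes $N_A$ and $N_B$, so that $\mathcal H\cong\mathcal H_A\otimes\mathcal H_B$. Let $\tilde{\mathscr P}_N$ be the set of the $4^N$ Pauli strings on $N$ qubits (tensor products of single-qubit operators $1,X,Y,Z$, taken up to phases), and let $\mathscr U_n$ be the unitary group on $n$ qubits. For a unitary $O$ on $\mathcal H$ with operator Schmidt decomposition $O/\sqrt d=\sum_i\sqrt{\lambda_i}\,X_i\otimes Y_i$, where $(X_i)$ and $(Y_i)$ are orthonormal for the Hilbert--Schmidt inner product on the operators on $\mathcal H_A$ and $\mathcal H_B$ respectively, and $\lambda_i>0$, the linear operator entanglement is $E_{\mathrm{lin}}(O)=1-\sum_i\lambda_i^2$. The linear operator stabilizer entropy of $O$ is $$M_{\mathrm{lin}}(O)=1-d^{-4}\sum_{P'\in\tilde{\mathscr P}_N}\bigl|\operatorname{Tr}(OP')\bigr|^4 .$$ The Pauli-entangling power of $U\in\mathscr U_N$ is the uniform average $$P_E(U)=\frac1{4^N}\sum_{P\in\tilde{\mathscr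 P}_N}E_{\mathrm{lin}}(U^\dagger PU).$$ Then for every $U\in\mathscr U_N$, $$P_E(U)=0\iff \exists\,V\in\mathscr U_{N_A},\ W\in\mathscr U_{N_B}\ \ \forall P\in\tilde{\mathscr P}_N:\quad M_{\mathrm{lin}}\bigl((V^\dagger\otimes W^\dagger)\,U^\dagger PU\,(V\otimes W)\bigr)=0 .$$ In particular, $V$ and $W$ do not depend on $P$. -/

import Mathlib

open scoped Kronecker Matrix

noncomputable section

namespace PauliEntangling

/-- Operators on the Hilbert space `(ℂ²)^{⊗ι}` of qubits labelled by `ι`, as matrices in the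
computational basis, which is indexed by bit strings `ι → Fin 2`. -/
abbrev Op (ι : Type) : Type := Matrix (ι → Fin 2) (ι → Fin 2) ℂ

/-- The single-qubit Pauli matrices `1, X, Y, Z`. -/
def pauli : Fin 4 → Matrix (Fin 2) (Fin 2) ℂ :=
  ![1, !![0, 1; 1, 0], !![0, -Complex.I; Complex.I, 0], !![1, 0; 0, -1]]

/-- The Pauli string `⨂ᵢ σ_{s i}`. The labels `s : Fin N → Fin 4` enumerate the Pauli group on `N`
qubits modulo phases, each class by its Hermitian representative with sign `+`. -/
def pauliString {N : ℕ} (s : Fin N → Fin 4) : Op (Fin N) :=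
  Matrix.of fun x y => ∏ i, pauli (s i) (x i) (y i)

variable {N : ℕ}

/-- The qubits of the subsystem `A`. -/
abbrev Inside (A : Finset (Fin N)) : Type := {i : Fin N // i ∈ A}

/-- The qubits of the complementary subsystem `B`. -/
abbrev Outside (A : Finset (Fin N)) : Type := {i : Fin N // i ∉ A}

/-- Splitting a bit string into its restrictions to `A` and to `B`: the identification
`ℋ ≅ ℋ_A ⊗ ℋ_B` on basis vectors. -/
def split (A : Finset (Fin N)) :
    (Fin N → Fin 2) ≃ (Inside A → Fin 2) × (Outside A → Fin 2) :=
  Equiv.piEquivPiSubtypeProd (fun i => i ∈ A) (fun _ => Fin 2)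

/-- The tensor product `V ⊗ W` of an operator on `A` and an operator on `B`, as an operator
on all `N` qubits. -/
def tensor (A : Finset (Fin N)) (V : Op (Inside A)) (W : Op (Outside A)) : Op (Fin N) :=
  (V ⊗ₖ W).submatrix (split A) (split A)

/-- The matrix of `O / √d`, `d = 2 ^ N`, seen as a vector in `End ℋ_A ⊗ End ℋ_B`: rows are indexed
by the matrix units of `A`, columns by the matrix units of `B`. -/
def realign (A : Finset (Fin N)) (O : Op (Fin N)) :
    Matrix ((Inside A → Fin 2) × (Inside A → Fin 2))
      ((Outside A → Fin 2) × (Outside A → Fin 2)) ℂ :=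
  Matrix.of fun a b =>
    ((Real.sqrt (2 ^ N))⁻¹ : ℂ) * O ((split A).symm (a.1, b.1)) ((split A).symm (a.2, b.2))

/-- The coefficients `λᵢ` of the operator Schmidt decomposition
`O / √d = ∑ᵢ √λᵢ Vᵢ ⊗ Wᵢ` (padded by zeros): the squared singular values of the realigned
matrix. -/
def schmidtCoeff (A : Finset (Fin N)) (O : Op (Fin N)) :
    (Inside A → Fin 2) × (Inside A → Fin 2) → ℝ :=
  (Matrix.isHermitian_mul_conjTranspose_self (realign A O)).eigenvalues

/-- The linear operator entanglement `E_lin(O) = 1 - ∑ᵢ λᵢ²` across the bipartition `A | B`. -/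
def linOpEntanglement (A : Finset (Fin N)) (O : Op (Fin N)) : ℝ :=
  1 - ∑ i, schmidtCoeff A O i ^ 2

/-- The linear operator stabilizer entropy `M_lin(O) = 1 - d⁻⁴ ∑_{P'} |Tr (O P')|⁴`. -/
def linOpStabEntropy (O : Op (Fin N)) : ℝ :=
  1 - ((2 : ℝ) ^ N)⁻¹ ^ 4 * ∑ s : Fin N → Fin 4, ‖(O * pauliString s).trace‖ ^ 4

/-- The Pauli-entangling power `P_E(U)`: the uniform average over the `4 ^ N` Pauli strings `P`
(up to phases) of `E_lin(U† P U)`. -/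
def pauliEntanglingPower (A : Finset (Fin N)) (U : Op (Fin N)) : ℝ :=
  ((4 : ℝ) ^ N)⁻¹ * ∑ s : Fin N → Fin 4, linOpEntanglement A (Uᴴ * pauliString s * U)

/-- `O / √d = ∑ᵢ √λᵢ Vᵢ ⊗ Wᵢ` with `λᵢ > 0` and `(Vᵢ)`, `(Wᵢ)` orthonormal for the
Hilbert-Schmidt inner product. -/
structure IsOperatorSchmidt (A : Finset (Fin N)) (O : Op (Fin N)) {ι : Type} [Fintype ι]
    [DecidableEq ι] (lam : ι → ℝ) (V : ι → Op (Inside A)) (W : ι → Op (Outside A)) : Prop where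
  pos : ∀ i, 0 < lam i
  orthoV : ∀ i j, ((V i)ᴴ * V j).trace = if i = j then 1 else 0
  orthoW : ∀ i j, ((W i)ᴴ * W j).trace = if i = j then 1 else 0
  decomp : ((Real.sqrt (2 ^ N))⁻¹ : ℂ) • O = ∑ i, (Real.sqrt (lam i) : ℂ) • tensor A (V i) (W i)

/-- Every operator has an operator Schmidt decomposition with the nonzero `schmidtCoeff`s as
coefficients. -/
theorem exists_isOperatorSchmidt (A : Finset (Fin N)) (O : Op (Fin N)) :
    ∃ (V : {i // 0 < schmidtCoeff A O i} → Op (Inside A))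
      (W : {i // 0 < schmidtCoeff A O i} → Op (Outside A)),
      IsOperatorSchmidt A O (fun i => schmidtCoeff A O i.1) V W := by
  classical
  set R := realign A O with hR
  set h := Matrix.isHermitian_mul_conjTranspose_self R with hh
  set Q : Matrix ((Inside A → Fin 2) × (Inside A → Fin 2))
      ((Inside A → Fin 2) × (Inside A → Fin 2)) ℂ := h.eigenvectorUnitary.1 with hQ
  have hQ1 : Qᴴ * Q = 1 := Unitary.coe_star_mul_self h.eigenvectorUnitary
  have hQ2 : Q * Qᴴ = 1 := Unitary.coe_mul_star_self h.eigenvectorUnitary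
  set S := Qᴴ * R with hS
  have hlam : ∀ i, schmidtCoeff A O i = h.eigenvalues i := fun i => rfl
  have hSS : S * Sᴴ = Matrix.diagonal (fun i => (schmidtCoeff A O i : ℂ)) := by
    have h1 : R * Rᴴ = Q * Matrix.diagonal (fun i => (schmidtCoeff A O i : ℂ)) * Qᴴ := by
      have := h.spectral_theorem
      rw [Unitary.conjStarAlgAut_apply] at this
      exact this
    rw [hS, Matrix.conjTranspose_mul, Matrix.conjTranspose_conjTranspose]
    calc Qᴴ * R * (Rᴴ * Q) = Qᴴ * (R * Rᴴ) * Q := by simp only [Matrix.mul_assoc]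
      _ = (Qᴴ * Q) * Matrix.diagonal (fun i => (schmidtCoeff A O i : ℂ)) * (Qᴴ * Q) := by
        rw [h1]; simp only [Matrix.mul_assoc]
      _ = _ := by rw [hQ1]; simp
  have hSe : ∀ i j, ∑ q, S i q * star (S j q) =
      if i = j then (schmidtCoeff A O i : ℂ) else 0 := by
    intro i j
    have := congrFun (congrFun hSS i) j
    rw [Matrix.mul_apply, Matrix.diagonal_apply] at this
    simpa [Matrix.conjTranspose_apply] using this
  have hQe : ∀ i j, ∑ p, star (Q p i) * Q p j = if i = j then 1 else 0 := by
    intro i j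
    have := congrFun (congrFun hQ1 i) j
    rw [Matrix.mul_apply, Matrix.one_apply] at this
    simpa [Matrix.conjTranspose_apply] using this
  have hnorm : ∀ i, ∑ q, ‖S i q‖ ^ 2 = schmidtCoeff A O i := by
    intro i
    have h1 := hSe i i
    rw [if_pos rfl] at h1
    have h3 : ((∑ q, ‖S i q‖ ^ 2 : ℝ) : ℂ) = schmidtCoeff A O i := by
      rw [← h1]
      push_cast
      refine Finset.sum_congr rfl fun q _ => ?_
      rw [← Complex.mul_conj']
      rfl
    exact_mod_cast h3
  have hnn : ∀ i, 0 ≤ schmidtCoeff A O i := fun i => by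
    rw [← hnorm i]
    positivity
  have hzero : ∀ i, ¬ 0 < schmidtCoeff A O i → ∀ q, S i q = 0 := by
    intro i hi q
    have h2 := hnorm i
    rw [le_antisymm (not_lt.mp hi) (hnn i)] at h2
    have h3 := (Finset.sum_eq_zero_iff_of_nonneg (fun q _ => by positivity)).1 h2 q
      (Finset.mem_univ q)
    simpa using h3
  have hsq : ∀ i : {i // 0 < schmidtCoeff A O i},
      (Real.sqrt (schmidtCoeff A O i.1) : ℂ) ≠ 0 := fun i => by
    exact_mod_cast (Real.sqrt_pos.2 i.2).ne'
  refine ⟨fun i => Matrix.of fun a a' => Q (a, a') i.1,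
    fun i => Matrix.of fun b b' => (Real.sqrt (schmidtCoeff A O i.1) : ℂ)⁻¹ * S i.1 (b, b'),
    fun i => i.2, ?_, ?_, ?_⟩
  · intro i j
    have := hQe i.1 j.1
    rw [Fintype.sum_prod_type, Finset.sum_comm] at this
    simpa [Matrix.trace, Matrix.mul_apply, Subtype.ext_iff] using this
  · intro i j
    have h1 := hSe j.1 i.1
    rw [Fintype.sum_prod_type, Finset.sum_comm] at h1
    have h2 : ∀ x y, star ((Real.sqrt (schmidtCoeff A O i.1) : ℂ)⁻¹ * S i.1 (x, y)) *
        ((Real.sqrt (schmidtCoeff A O j.1) : ℂ)⁻¹ * S j.1 (x, y)) =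
        ((Real.sqrt (schmidtCoeff A O i.1) : ℂ)⁻¹ * (Real.sqrt (schmidtCoeff A O j.1) : ℂ)⁻¹) *
        (S j.1 (x, y) * star (S i.1 (x, y))) := by
      intro x y
      simp only [star_mul', star_inv₀, Complex.star_def, Complex.conj_ofReal]
      ring
    simp only [Matrix.trace, Matrix.diag, Matrix.mul_apply, Matrix.conjTranspose_apply,
      Matrix.of_apply, h2, ← Finset.mul_sum, h1]
    by_cases hij : i = j
    · subst hij
      have h3 : (schmidtCoeff A O i.1 : ℂ) =
          (Real.sqrt (schmidtCoeff A O i.1) : ℂ) * (Real.sqrt (schmidtCoeff A O i.1) : ℂ) := by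
        rw [← Complex.ofReal_mul, Real.mul_self_sqrt (hnn _)]
      simp only [if_true]
      have := hsq i
      field_simp
      rw [h3]; ring
    · have : j.1 ≠ i.1 := fun h => hij (Subtype.ext h.symm)
      simp [this, hij]
  · ext x y
    have hRQ : R = Q * S := by rw [hS, ← Matrix.mul_assoc, hQ2, Matrix.one_mul]
    have h1 : ((Real.sqrt (2 ^ N))⁻¹ : ℂ) * O x y =
        R (((split A) x).1, ((split A) y).1) (((split A) x).2, ((split A) y).2) := by
      simp [hR, realign]
    have h2 : ∑ i ∈ Finset.univ.filter (fun i => 0 < schmidtCoeff A O i),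
        Q (((split A) x).1, ((split A) y).1) i * S i (((split A) x).2, ((split A) y).2) =
        ∑ i, Q (((split A) x).1, ((split A) y).1) i * S i (((split A) x).2, ((split A) y).2) := by
      refine Finset.sum_subset (Finset.filter_subset _ _) fun i _ hi => ?_
      rw [hzero i (by simpa using hi), mul_zero]
    rw [Matrix.smul_apply, smul_eq_mul, h1, hRQ, Matrix.mul_apply, ← h2, Matrix.sum_apply,
      Finset.sum_subtype (p := fun i => 0 < schmidtCoeff A O i) _ (by simp)]
    refine Finset.sum_congr rfl fun i _ => ?_
    have := hsq i
    simp only [tensor, Matrix.smul_apply, Matrix.submatrix_apply, Matrix.kroneckerMap_apply,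
      Matrix.of_apply, smul_eq_mul]
    field_simp

/-- `linOpEntanglement` is `1 - ∑ᵢ λᵢ²` for every operator Schmidt decomposition. -/
theorem linOpEntanglement_eq (A : Finset (Fin N)) (O : Op (Fin N)) {ι : Type} [Fintype ι]
    [DecidableEq ι] {lam : ι → ℝ} {V : ι → Op (Inside A)} {W : ι → Op (Outside A)}
    (hs : IsOperatorSchmidt A O lam V W) :
    linOpEntanglement A O = 1 - ∑ i, lam i ^ 2 := by
  classical
  set R := realign A O with hR
  set h := Matrix.isHermitian_mul_conjTranspose_self R with hh
  have key1 : ((R * Rᴴ) * (R * Rᴴ)).trace = ∑ i, (schmidtCoeff A O i : ℂ) ^ 2 := by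
    set Q : Matrix ((Inside A → Fin 2) × (Inside A → Fin 2))
      ((Inside A → Fin 2) × (Inside A → Fin 2)) ℂ := h.eigenvectorUnitary.1 with hQ
    have hQ1 : Qᴴ * Q = 1 := Unitary.coe_star_mul_self h.eigenvectorUnitary
    set D := Matrix.diagonal (fun i => (schmidtCoeff A O i : ℂ)) with hD
    have h1 : R * Rᴴ = Q * D * Qᴴ := by
      have := h.spectral_theorem
      rw [Unitary.conjStarAlgAut_apply] at this
      exact this
    have h2 : (R * Rᴴ) * (R * Rᴴ) = Q * (D * D) * Qᴴ := by
      rw [h1]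
      calc Q * D * Qᴴ * (Q * D * Qᴴ) = Q * D * (Qᴴ * Q) * D * Qᴴ := by
            simp only [Matrix.mul_assoc]
        _ = _ := by rw [hQ1]; simp only [Matrix.mul_assoc, Matrix.one_mul]
    rw [h2, Matrix.trace_mul_comm, ← Matrix.mul_assoc, hQ1, Matrix.one_mul, hD,
      Matrix.diagonal_mul_diagonal, Matrix.trace_diagonal]
    simp only [pow_two]
  let X : Matrix ((Inside A → Fin 2) × (Inside A → Fin 2)) ι ℂ :=
    Matrix.of fun a i => V i a.1 a.2
  let Y : Matrix ((Outside A → Fin 2) × (Outside A → Fin 2)) ι ℂ :=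
    Matrix.of fun b i => W i b.1 b.2
  set D : Matrix ι ι ℂ := Matrix.diagonal (fun i => (Real.sqrt (lam i) : ℂ)) with hD
  have hX : Xᴴ * X = 1 := by
    ext i j
    rw [Matrix.one_apply, ← hs.orthoV i j]
    simp only [X, Matrix.mul_apply, Matrix.trace, Matrix.diag, Matrix.conjTranspose_apply,
      Matrix.of_apply, Fintype.sum_prod_type]
    exact Finset.sum_comm
  have hY : Yᴴ * Y = 1 := by
    ext i j
    rw [Matrix.one_apply, ← hs.orthoW i j]
    simp only [Y, Matrix.mul_apply, Matrix.trace, Matrix.diag, Matrix.conjTranspose_apply,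
      Matrix.of_apply, Fintype.sum_prod_type]
    exact Finset.sum_comm
  have hY' : Yᵀ * Yᵀᴴ = 1 := by
    have := congrArg Matrix.transpose hY
    rw [Matrix.transpose_mul, Matrix.transpose_one] at this
    exact this
  have hRX : R = X * D * Yᵀ := by
    ext a b
    have h1 := congrFun (congrFun hs.decomp ((split A).symm (a.1, b.1)))
      ((split A).symm (a.2, b.2))
    rw [Matrix.smul_apply, smul_eq_mul, Matrix.sum_apply] at h1
    rw [hR, realign, Matrix.of_apply, h1, Matrix.mul_apply]
    refine Finset.sum_congr rfl fun i _ => ?_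
    simp only [hD, Matrix.mul_diagonal, tensor, Matrix.smul_apply, Matrix.submatrix_apply,
      Matrix.kroneckerMap_apply, Equiv.apply_symm_apply, smul_eq_mul, X, Y, Matrix.of_apply,
      Matrix.transpose_apply]
    ring
  have hDD : D * Dᴴ = Matrix.diagonal (fun i => (lam i : ℂ)) := by
    rw [hD, Matrix.diagonal_conjTranspose, Matrix.diagonal_mul_diagonal]
    congr 1
    funext i
    simp only [Pi.star_apply, Complex.star_def, Complex.conj_ofReal]
    rw [← Complex.ofReal_mul, Real.mul_self_sqrt (hs.pos i).le]
  have hG : R * Rᴴ = X * Matrix.diagonal (fun i => (lam i : ℂ)) * Xᴴ := by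
    rw [hRX, Matrix.conjTranspose_mul, Matrix.conjTranspose_mul]
    calc X * D * Yᵀ * (Yᵀᴴ * (Dᴴ * Xᴴ)) = X * D * (Yᵀ * Yᵀᴴ) * Dᴴ * Xᴴ := by
          simp only [Matrix.mul_assoc]
      _ = X * (D * Dᴴ) * Xᴴ := by rw [hY']; simp only [Matrix.mul_assoc, Matrix.one_mul]
      _ = _ := by rw [hDD]
  have key2 : ((R * Rᴴ) * (R * Rᴴ)).trace = ∑ i, (lam i : ℂ) ^ 2 := by
    set L := Matrix.diagonal (fun i => (lam i : ℂ)) with hL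
    have h2 : (R * Rᴴ) * (R * Rᴴ) = X * (L * L) * Xᴴ := by
      rw [hG]
      calc X * L * Xᴴ * (X * L * Xᴴ) = X * L * (Xᴴ * X) * L * Xᴴ := by
            simp only [Matrix.mul_assoc]
        _ = _ := by rw [hX]; simp only [Matrix.mul_assoc, Matrix.one_mul]
    rw [h2, Matrix.trace_mul_comm, ← Matrix.mul_assoc, hX, Matrix.one_mul, hL,
      Matrix.diagonal_mul_diagonal, Matrix.trace_diagonal]
    simp only [pow_two]
  have key : ∑ i, schmidtCoeff A O i ^ 2 = ∑ i, lam i ^ 2 := by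
    have := key1.symm.trans key2
    exact_mod_cast this
  rw [linOpEntanglement, key]

end PauliEntangling

end

open scoped Kronecker Matrix

noncomputable section

namespace PauliEntangling

section PauliStrings

variable {ι : Type} [Fintype ι]

/-- The tensor product of single-qubit operators. -/
def productOp (M : ι → Matrix (Fin 2) (Fin 2) ℂ) : Op ι :=
  Matrix.of fun x y => ∏ i, M i (x i) (y i)

/-- The Pauli string with labels `s` on the qubits `ι`. -/
def pauliOp (s : ι → Fin 4) : Op ι := productOp fun i => pauli (s i)

theorem productOp_mul [DecidableEq ι] (M M' : ι → Matrix (Fin 2) (Fin 2) ℂ) :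
    productOp M * productOp M' = productOp fun i => M i * M' i := by
  ext x y
  simp only [productOp, Matrix.mul_apply, Matrix.of_apply, ← Finset.prod_mul_distrib]
  rw [Finset.prod_univ_sum, Fintype.piFinset_univ]

theorem trace_productOp [DecidableEq ι] (M : ι → Matrix (Fin 2) (Fin 2) ℂ) :
    (productOp M).trace = ∏ i, (M i).trace := by
  simp only [productOp, Matrix.trace, Matrix.diag, Matrix.of_apply]
  rw [Finset.prod_univ_sum, Fintype.piFinset_univ]

theorem productOp_one [DecidableEq ι] :
    productOp (fun _ : ι => (1 : Matrix (Fin 2) (Fin 2) ℂ)) = 1 := by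
  ext x y
  simp only [productOp, Matrix.of_apply, Matrix.one_apply, Finset.prod_ite_zero,
    Finset.prod_const_one, funext_iff, Finset.mem_univ, true_imp_iff]

theorem productOp_smul (c : ι → ℂ) (M : ι → Matrix (Fin 2) (Fin 2) ℂ) :
    productOp (fun i => c i • M i) = (∏ i, c i) • productOp M := by
  ext x y
  simp [productOp, Finset.prod_mul_distrib]

theorem conjTranspose_productOp (M : ι → Matrix (Fin 2) (Fin 2) ℂ) :
    (productOp M)ᴴ = productOp fun i => (M i)ᴴ := by
  ext x y
  simp [productOp, Matrix.conjTranspose_apply]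

theorem pauli_zero : pauli 0 = 1 := rfl

theorem conjTranspose_pauli (a : Fin 4) : (pauli a)ᴴ = pauli a := by
  fin_cases a <;> ext i j <;> fin_cases i <;> fin_cases j <;>
    simp [pauli, Matrix.conjTranspose_apply]

theorem pauli_mul_self (a : Fin 4) : pauli a * pauli a = 1 := by
  fin_cases a <;> ext i j <;> fin_cases i <;> fin_cases j <;>
    simp [pauli, Matrix.mul_apply, Fin.sum_univ_two]

/-- Products of Pauli matrices are Pauli matrices up to a phase. -/
theorem exists_pauli_mul (a b : Fin 4) :
    ∃ (c : ℂ) (e : Fin 4), ‖c‖ = 1 ∧ pauli a * pauli b = c • pauli e := by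
  refine ⟨(![![1, 1, 1, 1], ![1, 1, Complex.I, -Complex.I], ![1, -Complex.I, 1, Complex.I],
    ![1, Complex.I, -Complex.I, 1]] : Fin 4 → Fin 4 → ℂ) a b,
    (![![0, 1, 2, 3], ![1, 0, 3, 2], ![2, 3, 0, 1], ![3, 2, 1, 0]] :
      Fin 4 → Fin 4 → Fin 4) a b, ?_, ?_⟩
  · fin_cases a <;> fin_cases b <;> simp
  · fin_cases a <;> fin_cases b <;> ext i j <;> fin_cases i <;> fin_cases j <;>
      simp [pauli, Matrix.mul_apply, Fin.sum_univ_two]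

/-- The sign by which two Pauli matrices commute. -/
def pauliSign (a b : Fin 4) : ℂ := if a = 0 ∨ b = 0 ∨ a = b then 1 else -1

theorem pauli_mul_comm (a b : Fin 4) :
    pauli a * pauli b = pauliSign a b • (pauli b * pauli a) := by
  fin_cases a <;> fin_cases b <;> ext i j <;> fin_cases i <;> fin_cases j <;>
    simp [pauli, pauliSign, Matrix.mul_apply, Fin.sum_univ_two]

theorem trace_pauli_mul (a b : Fin 4) :
    (pauli a * pauli b).trace = if a = b then 2 else 0 := by
  fin_cases a <;> fin_cases b <;>
    simp [pauli, Matrix.trace, Fin.sum_univ_two] <;> norm_num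

theorem sum_pauli_mul_pauli (u v x y : Fin 2) :
    ∑ a, pauli a v u * pauli a x y = if v = y ∧ u = x then 2 else 0 := by
  fin_cases u <;> fin_cases v <;> fin_cases x <;> fin_cases y <;>
    simp [pauli, Fin.sum_univ_four] <;> norm_num

variable [DecidableEq ι]

omit [DecidableEq ι] in
theorem conjTranspose_pauliOp (s : ι → Fin 4) : (pauliOp s)ᴴ = pauliOp s := by
  simp [pauliOp, conjTranspose_productOp, conjTranspose_pauli]

theorem pauliOp_mul_self (s : ι → Fin 4) : pauliOp s * pauliOp s = 1 := by
  simp [pauliOp, productOp_mul, pauli_mul_self, productOp_one]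

theorem pauliOp_mem_unitaryGroup (s : ι → Fin 4) :
    pauliOp s ∈ Matrix.unitaryGroup (ι → Fin 2) ℂ := by
  rw [Matrix.mem_unitaryGroup_iff, Matrix.star_eq_conjTranspose, conjTranspose_pauliOp,
    pauliOp_mul_self]

theorem exists_pauliOp_mul (s t : ι → Fin 4) :
    ∃ (c : ℂ) (e : ι → Fin 4), ‖c‖ = 1 ∧ pauliOp s * pauliOp t = c • pauliOp e := by
  choose c e hc h using fun i => exists_pauli_mul (s i) (t i)
  refine ⟨∏ i, c i, e, by simp [norm_prod, hc], ?_⟩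
  simp only [pauliOp, productOp_mul, h, productOp_smul]

theorem pauliOp_mul_comm (s t : ι → Fin 4) :
    pauliOp s * pauliOp t = (∏ i, pauliSign (s i) (t i)) • (pauliOp t * pauliOp s) := by
  rw [pauliOp, pauliOp, productOp_mul, productOp_mul, ← productOp_smul]
  simp only [← pauli_mul_comm]

theorem trace_pauliOp_mul (s t : ι → Fin 4) :
    (pauliOp s * pauliOp t).trace = if s = t then 2 ^ Fintype.card ι else 0 := by
  simp only [pauliOp, productOp_mul, trace_productOp, trace_pauli_mul, Finset.prod_ite_zero,
    Finset.prod_const, funext_iff, Finset.mem_univ, true_imp_iff, Finset.card_univ]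

theorem sum_pauliOp_mul_pauliOp (u v x y : ι → Fin 2) :
    ∑ s : ι → Fin 4, pauliOp s v u * pauliOp s x y =
      if v = y ∧ u = x then 2 ^ Fintype.card ι else 0 := by
  simp only [pauliOp, productOp, Matrix.of_apply, ← Finset.prod_mul_distrib]
  have := Finset.prod_univ_sum (fun _ : ι => (Finset.univ : Finset (Fin 4)))
    (fun i a => pauli a (v i) (u i) * pauli a (x i) (y i))
  rw [Fintype.piFinset_univ] at this
  rw [← this]
  simp only [sum_pauli_mul_pauli, Finset.prod_ite_zero, Finset.prod_const, funext_iff,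
    Finset.mem_univ, true_imp_iff, Finset.card_univ, forall_and]

/-- Expansion of an operator in Pauli strings. -/
theorem sum_trace_smul_pauliOp (O : Op ι) :
    ∑ s, (O * pauliOp s).trace • pauliOp s = (2 ^ Fintype.card ι : ℂ) • O := by
  ext x y
  simp only [Matrix.sum_apply, Matrix.smul_apply, smul_eq_mul, Matrix.trace, Matrix.diag,
    Matrix.mul_apply, Finset.sum_mul]
  rw [Finset.sum_comm]
  have h : ∀ u, ∑ s : ι → Fin 4, ∑ v, O u v * pauliOp s v u * pauliOp s x y =
      ∑ v, if v = y then (if u = x then O u v * 2 ^ Fintype.card ι else 0) else 0 := by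
    intro u
    rw [Finset.sum_comm]
    refine Finset.sum_congr rfl fun v _ => ?_
    simp only [mul_assoc, ← Finset.mul_sum, sum_pauliOp_mul_pauliOp, ite_and, mul_ite, mul_zero]
  simp only [h, Finset.sum_ite_eq', Finset.mem_univ, if_true]
  ring

theorem eq_sum_trace_smul_pauliOp (O : Op ι) :
    O = (2 ^ Fintype.card ι : ℂ)⁻¹ • ∑ s, (O * pauliOp s).trace • pauliOp s := by
  rw [sum_trace_smul_pauliOp, inv_smul_smul₀ (pow_ne_zero _ two_ne_zero)]

theorem span_range_pauliOp :
    Submodule.span ℂ (Set.range (pauliOp : (ι → Fin 4) → Op ι)) = ⊤ := by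
  refine eq_top_iff.2 fun O _ => ?_
  rw [eq_sum_trace_smul_pauliOp O]
  exact Submodule.smul_mem _ _ (Submodule.sum_mem _ fun s _ =>
    Submodule.smul_mem _ _ (Submodule.subset_span ⟨s, rfl⟩))

theorem sum_norm_trace_sq (O : Op ι) (hO : O ∈ Matrix.unitaryGroup (ι → Fin 2) ℂ) :
    ∑ s, ‖(O * pauliOp s).trace‖ ^ 2 = ((2 : ℝ) ^ Fintype.card ι) ^ 2 := by
  have h1 := congrArg (fun M => (M * Oᴴ).trace) (sum_trace_smul_pauliOp O)
  have h2 : ∀ s, (pauliOp s * Oᴴ).trace = star (O * pauliOp s).trace := by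
    intro s
    rw [← Matrix.trace_conjTranspose, Matrix.conjTranspose_mul, conjTranspose_pauliOp]
  have h3 : O * Oᴴ = 1 := Matrix.mem_unitaryGroup_iff.1 hO
  simp only [Finset.sum_mul, Matrix.trace_sum, Matrix.smul_mul, Matrix.trace_smul, h2, h3,
    Matrix.trace_one, smul_eq_mul, Complex.star_def, Complex.mul_conj'] at h1
  have h4 : Fintype.card (ι → Fin 2) = 2 ^ Fintype.card ι := by simp
  rw [h4] at h1
  rw [pow_two ((2 : ℝ) ^ _)]
  exact_mod_cast h1

end PauliStrings

section Frames

variable {σ ι n : Type}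

/-- The sign by which the generators `X_i = (i, true)`, `Z_i = (i, false)` of the Pauli group
commute. -/
def frameSign [DecidableEq σ] (t u : σ × Bool) : ℂ := if t.1 = u.1 ∧ t.2 ≠ u.2 then -1 else 1

/-- The conjugate generator: swaps `X_i` and `Z_i`. -/
def frameDual (t : σ × Bool) : σ × Bool := (t.1, !t.2)

/-- Operators `X_i`, `Z_i` satisfying the relations of the generators of the Pauli group. -/
structure IsPauliFrame [DecidableEq σ] [Fintype n] [DecidableEq n]
    (M : σ × Bool → Matrix n n ℂ) : Prop where
  mul_self : ∀ t, M t * M t = 1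
  mul_comm : ∀ t u, M t * M u = frameSign t u • (M u * M t)

section
variable [DecidableEq σ]

theorem frameSign_mul_self (t u : σ × Bool) : frameSign t u * frameSign t u = 1 := by
  unfold frameSign
  split_ifs <;> simp

theorem frameSign_dual (t : σ × Bool) : frameSign t (frameDual t) = -1 := by
  simp [frameSign, frameDual]

theorem frameSign_of_ne {t u : σ × Bool} (h : t ≠ u) : frameSign t (frameDual u) = 1 := by
  refine if_neg fun h' => h (Prod.ext h'.1 ?_)
  simpa [frameDual] using h'.2

theorem IsPauliFrame.dual_anticomm [Fintype n] [DecidableEq n] {M : σ × Bool → Matrix n n ℂ}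
    (hM : IsPauliFrame M) (t : σ × Bool) :
    M t * M (frameDual t) = -(M (frameDual t) * M t) := by
  rw [hM.mul_comm, frameSign_dual, neg_one_smul]

theorem IsPauliFrame.dual_comm [Fintype n] [DecidableEq n] {M : σ × Bool → Matrix n n ℂ}
    (hM : IsPauliFrame M) {t u : σ × Bool} (h : t ≠ u) :
    M t * M (frameDual u) = M (frameDual u) * M t := by
  rw [hM.mul_comm, frameSign_of_ne h, one_smul]

/-- Two Pauli frames with the same index set are intertwined by a nonzero operator. -/
theorem exists_intertwiner [Fintype n] [DecidableEq n] [Nonempty n] {m : Type} [Fintype m]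
    [DecidableEq m] [Nonempty m] {M : σ × Bool → Matrix n n ℂ} {M' : σ × Bool → Matrix m m ℂ}
    (hM : IsPauliFrame M) (hM' : IsPauliFrame M') (S : Finset (σ × Bool)) :
    ∃ V : Matrix n m ℂ, V ≠ 0 ∧ ∀ t ∈ S, M t * V = V * M' t := by
  induction S using Finset.induction_on with
  | empty =>
    refine ⟨Matrix.of fun _ _ => 1, fun h => ?_, by simp⟩
    have := congrFun (congrFun h (Classical.arbitrary n)) (Classical.arbitrary m)
    simp at this
  | insert a S ha ih =>
    obtain ⟨V, hV, hS⟩ := ih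
    by_cases hW : V + M a * V * M' a = 0
    · have h1 : M a * V = -(V * M' a) := by
        have h := eq_neg_of_add_eq_zero_left hW
        calc M a * V = M a * -(M a * V * M' a) := by rw [← h]
          _ = -(M a * M a * V * M' a) := by simp only [Matrix.mul_neg, Matrix.mul_assoc]
          _ = _ := by rw [hM.mul_self, Matrix.one_mul]
      refine ⟨M (frameDual a) * V, fun h => hV ?_, fun t ht => ?_⟩
      · rw [← Matrix.one_mul V, ← hM.mul_self (frameDual a), Matrix.mul_assoc, h, Matrix.mul_zero]
      · rcases Finset.mem_insert.1 ht with rfl | ht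
        · rw [← Matrix.mul_assoc, hM.dual_anticomm, Matrix.neg_mul, Matrix.mul_assoc, h1,
            Matrix.mul_neg, neg_neg, Matrix.mul_assoc]
        · rw [← Matrix.mul_assoc, hM.dual_comm (ne_of_mem_of_not_mem ht ha), Matrix.mul_assoc, hS t ht,
            Matrix.mul_assoc]
    · refine ⟨_, hW, fun t ht => ?_⟩
      rcases Finset.mem_insert.1 ht with rfl | ht
      · rw [Matrix.mul_add, Matrix.add_mul, Matrix.mul_assoc _ (M' t), hM'.mul_self,
          Matrix.mul_assoc (M t), ← Matrix.mul_assoc (M t) (M t), hM.mul_self, Matrix.one_mul,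
          Matrix.mul_one, add_comm]
      · rw [Matrix.mul_add, Matrix.add_mul, hS t ht]
        congr 1
        calc M t * (M a * V * M' a) = M t * M a * V * M' a := by simp only [Matrix.mul_assoc]
          _ = frameSign t a • (M a * (M t * V) * M' a) := by
            rw [hM.mul_comm, Matrix.smul_mul, Matrix.smul_mul]; simp only [Matrix.mul_assoc]
          _ = frameSign t a • (M a * V * (M' t * M' a)) := by
            rw [hS t ht]; simp only [Matrix.mul_assoc]
          _ = _ := by
            rw [hM'.mul_comm, Matrix.mul_smul, smul_smul, frameSign_mul_self, one_smul]
            simp only [Matrix.mul_assoc]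

end

section
variable [Fintype ι] [DecidableEq ι]

/-- The Pauli operators `X_i = (i, true)` and `Z_i = (i, false)`. -/
def pauliGen (t : ι × Bool) : Op ι := pauliOp (Pi.single t.1 (if t.2 then 1 else 3))

theorem pauliGen_mul_pauliOp (t : ι × Bool) (s : ι → Fin 4) :
    pauliGen t * pauliOp s =
      pauliSign (if t.2 then 1 else 3) (s t.1) • (pauliOp s * pauliGen t) := by
  rw [pauliGen, pauliOp_mul_comm, Finset.prod_eq_single t.1, Pi.single_eq_same]
  · intro i _ hi
    simp [Pi.single_eq_of_ne hi, pauliSign]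
  · simp

theorem isPauliFrame_pauliGen : IsPauliFrame (pauliGen : ι × Bool → Op ι) where
  mul_self t := pauliOp_mul_self _
  mul_comm t u := by
    conv_lhs => rw [pauliGen.eq_def u]
    rw [pauliGen_mul_pauliOp]
    congr 1
    obtain ⟨i, a⟩ := t
    obtain ⟨j, b⟩ := u
    by_cases h : i = j
    · subst h
      cases a <;> cases b <;> simp [pauliSign, frameSign]
    · simp [pauliSign, frameSign, h]

theorem pauliOp_zero : pauliOp (fun _ : ι => 0) = 1 := by
  simp only [pauliOp, pauli_zero, productOp_one]

/-- Operators commuting with all Pauli generators are scalars. -/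
theorem eq_smul_one_of_comm_pauliGen {M : Op ι} (h : ∀ t, pauliGen t * M = M * pauliGen t) :
    ∃ c : ℂ, M = c • (1 : Op ι) := by
  refine ⟨(2 ^ Fintype.card ι : ℂ)⁻¹ * M.trace, ?_⟩
  conv_lhs => rw [eq_sum_trace_smul_pauliOp M]
  rw [Finset.sum_eq_single (fun _ => 0), pauliOp_zero, Matrix.mul_one, smul_smul]
  · intro s _ hs
    obtain ⟨i, hi⟩ : ∃ i, s i ≠ 0 := by
      by_contra! h'
      exact hs (funext h')
    obtain ⟨b, hb⟩ : ∃ b : Bool, pauliSign (if b then 1 else 3) (s i) = -1 := by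
      by_cases h1 : s i = 1
      · exact ⟨false, by simp [pauliSign, h1]⟩
      · exact ⟨true, by simp [pauliSign, hi, Ne.symm h1]⟩
    have h1 := pauliGen_mul_pauliOp (i, b) s
    simp only [hb, neg_one_smul] at h1
    have h2 : (M * pauliOp s).trace = -(M * pauliOp s).trace := by
      calc (M * pauliOp s).trace
          = (M * pauliOp s * (pauliGen (i, b) * pauliGen (i, b))).trace := by
            rw [isPauliFrame_pauliGen.mul_self, Matrix.mul_one]
        _ = (pauliGen (i, b) * M * pauliOp s * pauliGen (i, b)).trace := by
            rw [← Matrix.mul_assoc, Matrix.trace_mul_comm]; simp only [Matrix.mul_assoc]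
        _ = (M * (pauliGen (i, b) * pauliOp s) * pauliGen (i, b)).trace := by
            rw [h]; simp only [Matrix.mul_assoc]
        _ = _ := by
            rw [h1, Matrix.mul_neg, Matrix.neg_mul, Matrix.trace_neg, ← Matrix.mul_assoc,
              Matrix.mul_assoc _ (pauliGen _), isPauliFrame_pauliGen.mul_self, Matrix.mul_one]
    rw [self_eq_neg.1 h2, zero_smul]
  · simp

/-- Operators commuting up to signs with all Pauli generators are multiples of Pauli strings. -/
theorem eq_smul_pauliOp_of_sign_comm {M : Op ι}
    (h : ∀ t, pauliGen t * M = M * pauliGen t ∨ pauliGen t * M = -(M * pauliGen t)) :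
    ∃ (c : ℂ) (s : ι → Fin 4), M = c • pauliOp s := by
  have h1 : ∀ t : ι × Bool, ∃ e : ℂ, (e = 1 ∨ e = -1) ∧ pauliGen t * M = e • (M * pauliGen t) := by
    intro t
    rcases h t with h | h
    · exact ⟨1, by simp, by simpa using h⟩
    · exact ⟨-1, by simp, by simpa using h⟩
  choose e he h2 using h1
  have h3 : ∀ i, ∃ a : Fin 4, ∀ b : Bool, pauliSign (if b then 1 else 3) a = e (i, b) := by
    intro i
    rcases he (i, true) with ht | ht <;> rcases he (i, false) with hf | hf
    · exact ⟨0, by simp [ht, hf, pauliSign]⟩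
    · exact ⟨1, by simp [ht, hf, pauliSign]⟩
    · exact ⟨3, by simp [ht, hf, pauliSign]⟩
    · exact ⟨2, by simp [ht, hf, pauliSign]⟩
  choose s hs using h3
  obtain ⟨c, hc⟩ := eq_smul_one_of_comm_pauliGen (M := M * pauliOp s) (by
    intro t
    rw [← Matrix.mul_assoc, h2, Matrix.smul_mul, Matrix.mul_assoc, pauliGen_mul_pauliOp, hs,
      Matrix.mul_smul, smul_smul, ← Matrix.mul_assoc]
    rcases he t with h | h <;> simp [h])
  refine ⟨c, s, ?_⟩
  rw [← Matrix.mul_one M, ← pauliOp_mul_self s, ← Matrix.mul_assoc, hc, Matrix.smul_mul,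
    Matrix.one_mul]

omit [Fintype ι] [DecidableEq ι] in
/-- A nonzero matrix whose Gram matrix is scalar is a multiple of a unitary. -/
theorem exists_unitary_of_conjTranspose_mul_self [Fintype n] [DecidableEq n] {V : Matrix n n ℂ}
    (hV : V ≠ 0) {c : ℂ} (hc : Vᴴ * V = c • (1 : Matrix n n ℂ)) :
    ∃ r : ℝ, 0 < r ∧ (r : ℂ) • V ∈ Matrix.unitaryGroup n ℂ := by
  obtain ⟨i, j, hij⟩ : ∃ i j, V i j ≠ 0 := by
    by_contra! h
    exact hV (Matrix.ext h)
  have h1 : ((∑ k, ‖V k j‖ ^ 2 : ℝ) : ℂ) = c := by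
    have := congrFun (congrFun hc j) j
    simp only [Matrix.mul_apply, Matrix.conjTranspose_apply, Matrix.smul_apply,
      Matrix.one_apply_eq, smul_eq_mul, mul_one, Complex.star_def, Complex.conj_mul'] at this
    rw [← this]
    push_cast
    rfl
  set q := ∑ k, ‖V k j‖ ^ 2 with hq
  have hpos : 0 < q :=
    Finset.sum_pos' (fun k _ => by positivity) ⟨i, Finset.mem_univ i, by positivity⟩
  refine ⟨(Real.sqrt q)⁻¹, by positivity, ?_⟩
  rw [Matrix.mem_unitaryGroup_iff', Matrix.star_eq_conjTranspose, Matrix.conjTranspose_smul,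
    Matrix.smul_mul, Matrix.mul_smul, hc, ← h1, smul_smul, smul_smul, Complex.star_def,
    Complex.conj_ofReal, ← Complex.ofReal_mul, ← Complex.ofReal_mul, ← mul_inv,
    Real.mul_self_sqrt hpos.le, inv_mul_cancel₀ hpos.ne', Complex.ofReal_one, one_smul]

/-- A unitary Pauli frame with as many pairs as qubits is unitarily equivalent to the Pauli
generators. -/
theorem IsPauliFrame.exists_unitary {M : ι × Bool → Op ι} (hM : IsPauliFrame M)
    (hU : ∀ t, M t ∈ Matrix.unitaryGroup (ι → Fin 2) ℂ) :
    ∃ V ∈ Matrix.unitaryGroup (ι → Fin 2) ℂ, ∀ t, M t * V = V * pauliGen t := by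
  obtain ⟨V, hV, h⟩ := exists_intertwiner hM isPauliFrame_pauliGen Finset.univ
  have hH : ∀ t, (M t)ᴴ = M t := fun t => by
    have := Matrix.mem_unitaryGroup_iff'.1 (hU t)
    rw [Matrix.star_eq_conjTranspose] at this
    rw [← Matrix.mul_one (M t)ᴴ, ← hM.mul_self t, ← Matrix.mul_assoc, this, Matrix.one_mul]
  have h1 : ∀ t, Vᴴ * M t = pauliGen t * Vᴴ := fun t => by
    have := congrArg Matrix.conjTranspose (h t (Finset.mem_univ t))
    rwa [Matrix.conjTranspose_mul, Matrix.conjTranspose_mul, hH, pauliGen,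
      conjTranspose_pauliOp] at this
  obtain ⟨c, hc⟩ := eq_smul_one_of_comm_pauliGen (M := Vᴴ * V) fun t => by
    rw [← Matrix.mul_assoc, ← h1, Matrix.mul_assoc, h t (Finset.mem_univ t), Matrix.mul_assoc]
  obtain ⟨r, -, hr⟩ := exists_unitary_of_conjTranspose_mul_self hV hc
  refine ⟨_, hr, fun t => ?_⟩
  rw [Matrix.mul_smul, h t (Finset.mem_univ t), Matrix.smul_mul]

end
end Frames

section PauliGroups

variable {n : Type} [Fintype n] [DecidableEq n]

/-- A set of unitaries with the structural properties of the Pauli group (with all phases). -/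
structure IsPauliLike (G : Set (Matrix n n ℂ)) : Prop where
  unitary : ∀ g ∈ G, g ∈ Matrix.unitaryGroup n ℂ
  mul_mem : ∀ g ∈ G, ∀ h ∈ G, g * h ∈ G
  smul_mem : ∀ c : ℂ, ‖c‖ = 1 → ∀ g ∈ G, c • g ∈ G
  exists_sq : ∀ g ∈ G, ∃ c : ℂ, g * g = c • (1 : Matrix n n ℂ)
  span_eq_top : Submodule.span ℂ G = ⊤

theorem norm_eq_one_of_smul_mem_unitaryGroup [Nonempty n] {g : Matrix n n ℂ} {c : ℂ}
    (hg : g ∈ Matrix.unitaryGroup n ℂ) (hc : c • g ∈ Matrix.unitaryGroup n ℂ) : ‖c‖ = 1 := by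
  rw [Matrix.mem_unitaryGroup_iff, Matrix.star_eq_conjTranspose] at hg hc
  rw [Matrix.conjTranspose_smul, Matrix.smul_mul, Matrix.mul_smul, hg, smul_smul,
    Complex.star_def, Complex.mul_conj'] at hc
  have h := congrFun (congrFun hc (Classical.arbitrary n)) (Classical.arbitrary n)
  simp only [Matrix.smul_apply, Matrix.one_apply_eq, smul_eq_mul, mul_one] at h
  have h' : ‖c‖ ^ 2 = 1 := by exact_mod_cast h
  exact (pow_eq_one_iff_of_nonneg (norm_nonneg c) two_ne_zero).1 h'

namespace IsPauliLike

variable [Nonempty n] {G : Set (Matrix n n ℂ)} (hG : IsPauliLike G)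
include hG

theorem norm_sq_eq_one {g : Matrix n n ℂ} (hg : g ∈ G) {c : ℂ}
    (hc : g * g = c • (1 : Matrix n n ℂ)) : ‖c‖ = 1 :=
  norm_eq_one_of_smul_mem_unitaryGroup (one_mem _) (hc ▸ hG.unitary _ (hG.mul_mem g hg g hg))

theorem comm_or_anticomm {g h : Matrix n n ℂ} (hg : g ∈ G) (hh : h ∈ G) :
    g * h = h * g ∨ g * h = -(h * g) := by
  obtain ⟨a, ha⟩ := hG.exists_sq g hg
  obtain ⟨b, hb⟩ := hG.exists_sq h hh
  obtain ⟨c, hc⟩ := hG.exists_sq _ (hG.mul_mem g hg h hh)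
  have ha0 : a ≠ 0 := norm_ne_zero_iff.1 (by rw [hG.norm_sq_eq_one hg ha]; exact one_ne_zero)
  have hc0 : c ≠ 0 := norm_ne_zero_iff.1
    (by rw [hG.norm_sq_eq_one (hG.mul_mem g hg h hh) hc]; exact one_ne_zero)
  have h1 : (a * b) • (h * g) = c • (g * h) := by
    calc (a * b) • (h * g) = (a • 1) * (h * g) * (b • 1) := by simp [smul_smul, mul_comm]
      _ = g * (g * h * (g * h)) * h := by rw [← ha, ← hb]; simp only [Matrix.mul_assoc]
      _ = _ := by rw [hc]; simp
  have h2 : g * h = (c⁻¹ * (a * b)) • (h * g) := by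
    rw [mul_smul, h1, inv_smul_smul₀ hc0]
  set κ := c⁻¹ * (a * b)
  have h3 : a • h = (κ * κ * a) • h := by
    calc a • h = g * g * h := by rw [ha]; simp
      _ = (κ * κ) • (h * (g * g)) := by
        rw [Matrix.mul_assoc, h2, Matrix.mul_smul, ← Matrix.mul_assoc, h2, Matrix.smul_mul,
          smul_smul, Matrix.mul_assoc]
      _ = _ := by rw [ha]; simp [smul_smul]
  have hh0 : h ≠ 0 := by
    rintro rfl
    simpa using Matrix.mem_unitaryGroup_iff.1 (hG.unitary _ hh)
  have h4 : κ * κ = 1 := by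
    have := smul_left_injective ℂ hh0 h3
    exact mul_right_cancel₀ ha0 (by rw [← this, one_mul])
  rcases mul_self_eq_one_iff.1 h4 with h | h <;> rw [h] at h2
  · exact Or.inl (by simpa using h2)
  · exact Or.inr (by simpa using h2)

theorem exists_phase_mul_self {g : Matrix n n ℂ} (hg : g ∈ G) :
    ∃ c : ℂ, c • g ∈ G ∧ (c • g) * (c • g) = 1 := by
  obtain ⟨a, ha⟩ := hG.exists_sq g hg
  have ha1 := hG.norm_sq_eq_one hg ha
  obtain ⟨c, hc⟩ := IsAlgClosed.exists_pow_nat_eq a⁻¹ (n := 2) two_pos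
  have hc1 : ‖c‖ = 1 := by
    have : ‖c‖ ^ 2 = 1 := by rw [← norm_pow, hc, norm_inv, ha1, inv_one]
    exact (pow_eq_one_iff_of_nonneg (norm_nonneg c) two_ne_zero).1 this
  refine ⟨c, hG.smul_mem c hc1 g hg, ?_⟩
  have ha0 : a ≠ 0 := norm_ne_zero_iff.1 (by rw [ha1]; exact one_ne_zero)
  rw [Matrix.smul_mul, Matrix.mul_smul, smul_smul, ha, smul_smul, ← pow_two, hc,
    inv_mul_cancel₀ ha0, one_smul]

omit [Nonempty n] in
theorem eq_smul_one_of_comm {g : Matrix n n ℂ} (hg : ∀ h ∈ G, h * g = g * h) :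
    ∃ c : ℂ, g = c • (1 : Matrix n n ℂ) := by
  have h1 : ∀ M : Matrix n n ℂ, M * g = g * M := by
    intro M
    have hM : M ∈ Submodule.span ℂ G := hG.span_eq_top ▸ Submodule.mem_top
    induction hM using Submodule.span_induction with
    | mem x hx => exact hg x hx
    | zero => simp
    | add x y _ _ hx hy => rw [add_mul, mul_add, hx, hy]
    | smul c x _ hx => rw [Matrix.smul_mul, Matrix.mul_smul, hx]
  obtain ⟨c, hc⟩ := Matrix.mem_range_scalar_of_commute_single (M := g) fun i j _ => h1 _
  exact ⟨c, by rw [← hc, Matrix.scalar_apply, Matrix.smul_one_eq_diagonal]⟩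

theorem card_sq_le {σ : Type} [Fintype σ] [DecidableEq σ] {M : σ → Matrix n n ℂ}
    (hM : ∀ t, M t ∈ G)
    (hs : ∀ g ∈ G, (∀ t, M t * g = g * M t) → ∃ c : ℂ, g = c • (1 : Matrix n n ℂ)) :
    Fintype.card n * Fintype.card n ≤ 2 ^ Fintype.card σ := by
  classical
  let P : (σ → Bool) → Matrix n n ℂ → Prop := fun f g =>
    g ∈ G ∧ ∀ t, (M t * g = g * M t ↔ f t = true)
  let r : (σ → Bool) → Matrix n n ℂ := fun f => if h : ∃ g, P f g then h.choose else 0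
  have hr : ∀ f g, P f g → P f (r f) := fun f g h => by
    have h' : ∃ g, P f g := ⟨g, h⟩
    simp only [r, dif_pos h']
    exact h'.choose_spec
  have hspan : Submodule.span ℂ (Set.range r) = ⊤ := by
    rw [eq_top_iff, ← hG.span_eq_top, Submodule.span_le]
    intro g hg
    set f : σ → Bool := fun t => decide (M t * g = g * M t) with hf
    have hPg : P f g := ⟨hg, fun t => by simp [hf]⟩
    obtain ⟨h0, h1⟩ := hr f g hPg
    obtain ⟨c, hc⟩ := hs _ (hG.mul_mem g hg _ h0) fun t => by
      by_cases hft : f t = true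
      · rw [← Matrix.mul_assoc, (hPg.2 t).2 hft, Matrix.mul_assoc, (h1 t).2 hft, Matrix.mul_assoc]
      · have e1 := (hG.comm_or_anticomm (hM t) hg).resolve_left (mt (hPg.2 t).1 hft)
        have e2 := (hG.comm_or_anticomm (hM t) h0).resolve_left (mt (h1 t).1 hft)
        rw [← Matrix.mul_assoc, e1, Matrix.neg_mul, Matrix.mul_assoc, e2, Matrix.mul_neg, neg_neg,
          Matrix.mul_assoc]
    obtain ⟨a, ha⟩ := hG.exists_sq _ h0
    have ha0 : a ≠ 0 := norm_ne_zero_iff.1 (by rw [hG.norm_sq_eq_one h0 ha]; exact one_ne_zero)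
    have h2 : a • g = c • r f := by
      have : g * r f * r f = c • r f := by rw [hc, Matrix.smul_mul, Matrix.one_mul]
      rwa [Matrix.mul_assoc, ha, Matrix.mul_smul, Matrix.mul_one] at this
    have h3 : g = (a⁻¹ * c) • r f := by rw [mul_smul, ← h2, inv_smul_smul₀ ha0]
    rw [h3]
    exact Submodule.smul_mem _ _ (Submodule.subset_span ⟨f, rfl⟩)
  have h1 := finrank_range_le_card (R := ℂ) r
  rw [Set.finrank, hspan, finrank_top, Module.finrank_matrix, Module.finrank_self, mul_one] at h1
  simpa using h1

theorem exists_anticomm_comm_frame {σ : Type} [DecidableEq σ] {M : σ × Bool → Matrix n n ℂ}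
    (hMG : ∀ t, M t ∈ G) (hM : IsPauliFrame M) {g : Matrix n n ℂ}
    (hgM : ∀ t, M t * g = g * M t) {h : Matrix n n ℂ} (hh : h ∈ G) (hgh : g * h = -(h * g))
    (S : Finset (σ × Bool)) :
    ∃ h ∈ G, g * h = -(h * g) ∧ ∀ t ∈ S, M t * h = h * M t := by
  induction S using Finset.induction_on with
  | empty => exact ⟨h, hh, hgh, by simp⟩
  | insert a S ha ih =>
    obtain ⟨k, hk, hgk, hS⟩ := ih
    rcases hG.comm_or_anticomm (hMG a) hk with hc | hc
    · refine ⟨k, hk, hgk, fun t ht => ?_⟩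
      rcases Finset.mem_insert.1 ht with rfl | ht
      exacts [hc, hS t ht]
    · refine ⟨M (frameDual a) * k, hG.mul_mem _ (hMG _) _ hk, ?_, fun t ht => ?_⟩
      · rw [← Matrix.mul_assoc, ← hgM, Matrix.mul_assoc, hgk, Matrix.mul_neg, Matrix.mul_assoc]
      · rcases Finset.mem_insert.1 ht with rfl | ht
        · rw [← Matrix.mul_assoc, hM.dual_anticomm, Matrix.neg_mul, Matrix.mul_assoc, hc,
            Matrix.mul_neg, neg_neg, Matrix.mul_assoc]
        · rw [← Matrix.mul_assoc, hM.dual_comm (ne_of_mem_of_not_mem ht ha), Matrix.mul_assoc,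
            hS t ht, Matrix.mul_assoc]

theorem exists_frame (j : ℕ) (hj : 4 ^ j ≤ Fintype.card n * Fintype.card n) :
    ∃ M : Fin j × Bool → Matrix n n ℂ, IsPauliFrame M ∧ ∀ t, M t ∈ G := by
  induction j with
  | zero => exact ⟨fun t => t.1.elim0, ⟨fun t => t.1.elim0, fun t => t.1.elim0⟩, fun t => t.1.elim0⟩
  | succ j ih =>
    have hj' : 4 ^ j < Fintype.card n * Fintype.card n :=
      (Nat.pow_lt_pow_right (by norm_num) j.lt_succ_self).trans_le hj
    obtain ⟨M, hM, hMG⟩ := ih hj'.le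
    obtain ⟨g, hg, hgM, hgs⟩ : ∃ g ∈ G, (∀ t, M t * g = g * M t) ∧
        ¬ ∃ c : ℂ, g = c • (1 : Matrix n n ℂ) := by
      by_contra! hcon
      have h1 := hG.card_sq_le hMG fun g hg hgM => hcon g hg hgM
      rw [Fintype.card_prod, Fintype.card_fin, Fintype.card_bool, mul_comm j, pow_mul] at h1
      norm_num at h1
      omega
    obtain ⟨h, hh, hne⟩ : ∃ h ∈ G, ¬ h * g = g * h := by
      by_contra! hcon
      exact hgs (hG.eq_smul_one_of_comm hcon)
    obtain ⟨h, hh, hgh, hhM⟩ := hG.exists_anticomm_comm_frame hMG hM hgM hh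
      ((hG.comm_or_anticomm hg hh).resolve_left fun h => hne h.symm) Finset.univ
    obtain ⟨a, haG, ha⟩ := hG.exists_phase_mul_self hg
    obtain ⟨b, hbG, hb⟩ := hG.exists_phase_mul_self hh
    set g' := a • g with hg'
    set h' := b • h with hh'
    have hgM' : ∀ t, M t * g' = g' * M t := fun t => by
      rw [hg', Matrix.mul_smul, Matrix.smul_mul, hgM]
    have hhM' : ∀ t, M t * h' = h' * M t := fun t => by
      rw [hh', Matrix.mul_smul, Matrix.smul_mul, hhM t (Finset.mem_univ t)]
    have hgh' : g' * h' = -(h' * g') := by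
      rw [hg', hh', Matrix.smul_mul, Matrix.mul_smul, Matrix.smul_mul, Matrix.mul_smul, hgh,
        smul_neg, smul_neg, smul_comm]
    refine ⟨fun t => Fin.cases (if t.2 then h' else g') (fun i => M (i, t.2)) t.1, ⟨?_, ?_⟩, ?_⟩
    · rintro ⟨i, x⟩
      refine Fin.cases ?_ (fun i => ?_) i
      · cases x <;> simp [ha, hb]
      · simp [hM.mul_self]
    · rintro ⟨i, x⟩ ⟨k, y⟩
      refine Fin.cases ?_ (fun i => ?_) i <;> refine Fin.cases ?_ (fun k => ?_) k
      · cases x <;> cases y <;> simp [frameSign, hgh']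
      · cases x <;> simp [frameSign, (Fin.succ_ne_zero _).symm, hgM', hhM']
      · cases y <;> simp [frameSign, hgM', hhM']
      · simpa [frameSign] using hM.mul_comm (i, x) (k, y)
    · rintro ⟨i, x⟩
      refine Fin.cases ?_ (fun i => hMG _) i
      cases x <;> simp [haG, hbG]

end IsPauliLike

/-- A Pauli-like set of unitaries on qubits is unitarily equivalent to the Pauli group. -/
theorem IsPauliLike.exists_unitary {ι : Type} [Fintype ι] [DecidableEq ι] {G : Set (Op ι)}
    (hG : IsPauliLike G) :
    ∃ V ∈ Matrix.unitaryGroup (ι → Fin 2) ℂ,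
      ∀ g ∈ G, ∃ (c : ℂ) (s : ι → Fin 4), Vᴴ * g * V = c • pauliOp s := by
  obtain ⟨M₀, hM₀, hMG₀⟩ := hG.exists_frame (Fintype.card ι) (by
    simp only [Fintype.card_pi, Fintype.card_fin, Finset.prod_const, Finset.card_univ]
    rw [← mul_pow]
    norm_num)
  let e := Fintype.equivFin ι
  let M : ι × Bool → Op ι := fun t => M₀ (e t.1, t.2)
  have hM : IsPauliFrame M := ⟨fun t => hM₀.mul_self _, fun t u => by
    simpa [frameSign] using hM₀.mul_comm (e t.1, t.2) (e u.1, u.2)⟩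
  obtain ⟨V, hV, h⟩ := hM.exists_unitary fun t => hG.unitary _ (hMG₀ _)
  have hV1 : V * Vᴴ = 1 := Matrix.mem_unitaryGroup_iff.1 hV
  have hV2 : Vᴴ * V = 1 := Matrix.mem_unitaryGroup_iff'.1 hV
  refine ⟨V, hV, fun g hg => eq_smul_pauliOp_of_sign_comm fun t => ?_⟩
  have hgen : pauliGen t = Vᴴ * M t * V := by
    rw [Matrix.mul_assoc, h, ← Matrix.mul_assoc, hV2, Matrix.one_mul]
  have h1 : ∀ X Y : Op ι, Vᴴ * X * V * (Vᴴ * Y * V) = Vᴴ * (X * Y) * V := fun X Y => by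
    calc _ = Vᴴ * X * (V * Vᴴ) * Y * V := by simp only [Matrix.mul_assoc]
      _ = _ := by rw [hV1]; simp only [Matrix.mul_assoc, Matrix.one_mul]
  rw [hgen, h1, h1]
  rcases hG.comm_or_anticomm (hMG₀ (e t.1, t.2)) hg with h2 | h2
  · exact Or.inl (by rw [h2])
  · exact Or.inr (by rw [h2, Matrix.mul_neg, Matrix.neg_mul])

end PauliGroups

section Factorization

variable {m n p : Type}

/-- The Kronecker product transported along an identification of the index types. -/
def kronAlong (e : p ≃ m × n) (g : Matrix m m ℂ) (h : Matrix n n ℂ) : Matrix p p ℂ :=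
  (g ⊗ₖ h).submatrix e e

theorem kronAlong_apply (e : p ≃ m × n) (g : Matrix m m ℂ) (h : Matrix n n ℂ) (x y : p) :
    kronAlong e g h x y = g (e x).1 (e y).1 * h (e x).2 (e y).2 := rfl

theorem kronAlong_swap (e : p ≃ m × n) (g : Matrix m m ℂ) (h : Matrix n n ℂ) :
    kronAlong (e.trans (Equiv.prodComm m n)) h g = kronAlong e g h := by
  ext x y
  simp [kronAlong_apply, mul_comm]

theorem kronAlong_smul_left (e : p ≃ m × n) (c : ℂ) (g : Matrix m m ℂ) (h : Matrix n n ℂ) :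
    kronAlong e (c • g) h = c • kronAlong e g h := by
  ext x y
  simp [kronAlong_apply, mul_assoc]

theorem kronAlong_smul_right (e : p ≃ m × n) (c : ℂ) (g : Matrix m m ℂ) (h : Matrix n n ℂ) :
    kronAlong e g (c • h) = c • kronAlong e g h := by
  ext x y
  simp [kronAlong_apply, mul_left_comm]

theorem conjTranspose_kronAlong (e : p ≃ m × n) (g : Matrix m m ℂ) (h : Matrix n n ℂ) :
    (kronAlong e g h)ᴴ = kronAlong e gᴴ hᴴ := by
  ext x y
  simp [kronAlong_apply, Matrix.conjTranspose_apply]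

variable [Fintype m] [Fintype n] [Fintype p] [DecidableEq m] [DecidableEq n] [DecidableEq p]

omit [DecidableEq m] [DecidableEq n] [DecidableEq p] in
theorem kronAlong_mul (e : p ≃ m × n) (g g' : Matrix m m ℂ) (h h' : Matrix n n ℂ) :
    kronAlong e g h * kronAlong e g' h' = kronAlong e (g * g') (h * h') := by
  rw [kronAlong, kronAlong, kronAlong, Matrix.submatrix_mul_equiv, Matrix.mul_kronecker_mul]

omit [Fintype m] [Fintype n] [Fintype p] in
theorem kronAlong_one (e : p ≃ m × n) : kronAlong e (1 : Matrix m m ℂ) (1 : Matrix n n ℂ) = 1 := by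
  rw [kronAlong, Matrix.one_kronecker_one, Matrix.submatrix_one_equiv]

theorem kronAlong_mem_unitaryGroup (e : p ≃ m × n) {g : Matrix m m ℂ} {h : Matrix n n ℂ}
    (hg : g ∈ Matrix.unitaryGroup m ℂ) (hh : h ∈ Matrix.unitaryGroup n ℂ) :
    kronAlong e g h ∈ Matrix.unitaryGroup p ℂ := by
  rw [Matrix.mem_unitaryGroup_iff, Matrix.star_eq_conjTranspose] at *
  rw [conjTranspose_kronAlong, kronAlong_mul, hg, hh, kronAlong_one]

omit [Fintype m] [Fintype n] [Fintype p] [DecidableEq n] in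
theorem eq_smul_one_of_kronAlong_eq [Nonempty m] [Nonempty n] (e : p ≃ m × n) {g : Matrix m m ℂ}
    {h : Matrix n n ℂ} {c : ℂ} (hc : c ≠ 0) (hgh : kronAlong e g h = c • (1 : Matrix p p ℂ)) :
    ∃ a : ℂ, g = a • (1 : Matrix m m ℂ) := by
  let k := Classical.arbitrary n
  have h1 : ∀ i j, g i j * h k k = if i = j then c else 0 := by
    intro i j
    have := congrFun (congrFun hgh (e.symm (i, k))) (e.symm (j, k))
    simpa [kronAlong_apply, Matrix.one_apply] using this
  have hk : h k k ≠ 0 := fun h0 => hc (by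
    simpa [h0] using (h1 (Classical.arbitrary m) (Classical.arbitrary m)).symm)
  refine ⟨c / h k k, ?_⟩
  ext i j
  rw [eq_div_of_mul_eq hk (h1 i j), Matrix.smul_apply, Matrix.one_apply]
  split_ifs <;> simp

theorem exists_unitary_factors [Nonempty m] [Nonempty n] (e : p ≃ m × n) {g : Matrix m m ℂ}
    {h : Matrix n n ℂ} (hgh : kronAlong e g h ∈ Matrix.unitaryGroup p ℂ) :
    ∃ g' ∈ Matrix.unitaryGroup m ℂ, ∃ h' ∈ Matrix.unitaryGroup n ℂ,
      kronAlong e g h = kronAlong e g' h' := by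
  have : Nonempty p := e.nonempty
  have h1 : kronAlong e (gᴴ * g) (hᴴ * h) = (1 : ℂ) • (1 : Matrix p p ℂ) := by
    rw [← kronAlong_mul, ← conjTranspose_kronAlong, one_smul]
    exact Matrix.mem_unitaryGroup_iff'.1 hgh
  have hne : kronAlong e g h ≠ 0 := fun h0 => by
    rw [h0] at hgh
    simpa using Matrix.mem_unitaryGroup_iff.1 hgh
  have hg0 : g ≠ 0 := by
    rintro rfl
    exact hne (by ext; simp [kronAlong_apply])
  have hh0 : h ≠ 0 := by
    rintro rfl
    exact hne (by ext; simp [kronAlong_apply])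
  obtain ⟨a, ha⟩ := eq_smul_one_of_kronAlong_eq e one_ne_zero h1
  obtain ⟨b, hb⟩ := eq_smul_one_of_kronAlong_eq (e.trans (Equiv.prodComm m n)) one_ne_zero
    ((kronAlong_swap e _ _).trans h1)
  obtain ⟨r, hr, hrg⟩ := exists_unitary_of_conjTranspose_mul_self hg0 ha
  obtain ⟨s, hs, hsh⟩ := exists_unitary_of_conjTranspose_mul_self hh0 hb
  refine ⟨_, hrg, _, hsh, ?_⟩
  have h2 := kronAlong_mem_unitaryGroup e hrg hsh
  rw [kronAlong_smul_left, kronAlong_smul_right, smul_smul] at h2 ⊢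
  have h3 := norm_eq_one_of_smul_mem_unitaryGroup hgh h2
  rw [← Complex.ofReal_mul, Complex.norm_real, Real.norm_of_nonneg (by positivity)] at h3
  rw [← Complex.ofReal_mul, h3, Complex.ofReal_one, one_smul]

/-- The local factors of a Pauli-like set of product operators form a Pauli-like set. -/
theorem IsPauliLike.factor [Nonempty m] [Nonempty n] (e : p ≃ m × n) {G : Set (Matrix p p ℂ)}
    (hG : IsPauliLike G)
    (hprod : ∀ x ∈ G, ∃ g ∈ Matrix.unitaryGroup m ℂ, ∃ h ∈ Matrix.unitaryGroup n ℂ,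
      x = kronAlong e g h) :
    IsPauliLike {g : Matrix m m ℂ | g ∈ Matrix.unitaryGroup m ℂ ∧
      ∃ h ∈ Matrix.unitaryGroup n ℂ, kronAlong e g h ∈ G} where
  unitary g hg := hg.1
  mul_mem := by
    rintro g ⟨hg, h, hh, hgh⟩ g' ⟨hg', h', hh', hgh'⟩
    exact ⟨MulMemClass.mul_mem hg hg', _, MulMemClass.mul_mem hh hh', by
      rw [← kronAlong_mul]; exact hG.mul_mem _ hgh _ hgh'⟩
  smul_mem := by
    rintro c hc g ⟨hg, h, hh, hgh⟩
    refine ⟨?_, h, hh, by rw [kronAlong_smul_left]; exact hG.smul_mem c hc _ hgh⟩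
    rw [Matrix.mem_unitaryGroup_iff, Matrix.star_eq_conjTranspose] at *
    rw [Matrix.conjTranspose_smul, Matrix.smul_mul, Matrix.mul_smul, hg, smul_smul,
      Complex.star_def, Complex.mul_conj', hc]
    simp
  exists_sq := by
    have : Nonempty p := e.nonempty
    rintro g ⟨hg, h, hh, hgh⟩
    obtain ⟨c, hc⟩ := hG.exists_sq _ hgh
    have hc0 : c ≠ 0 := norm_ne_zero_iff.1 (by rw [hG.norm_sq_eq_one hgh hc]; exact one_ne_zero)
    rw [kronAlong_mul] at hc
    exact eq_smul_one_of_kronAlong_eq e hc0 hc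
  span_eq_top := by
    refine eq_top_iff.2 fun X _ => ?_
    let k := Classical.arbitrary n
    let L : Matrix p p ℂ → Matrix m m ℂ := fun Y =>
      Y.submatrix (fun i => e.symm (i, k)) (fun i => e.symm (i, k))
    have hL : ∀ (g : Matrix m m ℂ) (h : Matrix n n ℂ), L (kronAlong e g h) = h k k • g := by
      intro g h
      ext i j
      simp [L, kronAlong_apply, mul_comm]
    have h1 : ∀ Y : Matrix p p ℂ, L Y ∈ Submodule.span ℂ {g : Matrix m m ℂ |
        g ∈ Matrix.unitaryGroup m ℂ ∧ ∃ h ∈ Matrix.unitaryGroup n ℂ, kronAlong e g h ∈ G} := by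
      intro Y
      have hY : Y ∈ Submodule.span ℂ G := hG.span_eq_top ▸ Submodule.mem_top
      induction hY using Submodule.span_induction with
      | mem x hx =>
        obtain ⟨g, hg, h, hh, rfl⟩ := hprod x hx
        rw [hL]
        exact Submodule.smul_mem _ _ (Submodule.subset_span ⟨hg, h, hh, hx⟩)
      | zero => exact Submodule.zero_mem _
      | add x y _ _ hx hy => exact Submodule.add_mem _ hx hy
      | smul c x _ hx => exact Submodule.smul_mem _ c hx
    have h2 := h1 (kronAlong e X 1)
    rwa [hL, Matrix.one_apply_eq, one_smul] at h2

end Factorization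

section Entropies

/-- A probability vector of unit Euclidean length is a point mass. -/
theorem exists_eq_one_of_sum_sq_eq_one {κ : Type} [Fintype κ] {a : κ → ℝ} (h0 : ∀ i, 0 ≤ a i)
    (h1 : ∑ i, a i = 1) (h2 : ∑ i, a i ^ 2 = 1) : ∃ i, a i = 1 ∧ ∀ j, j ≠ i → a j = 0 := by
  classical
  have hle : ∀ i, a i ≤ 1 := fun i => by
    rw [← h1]
    exact Finset.single_le_sum (fun j _ => h0 j) (Finset.mem_univ i)
  have h3 : ∑ i, a i * (1 - a i) = 0 := by
    simp only [mul_sub, mul_one, ← pow_two, Finset.sum_sub_distrib, h1, h2, sub_self]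
  have h4 := (Finset.sum_eq_zero_iff_of_nonneg
    (fun i _ => mul_nonneg (h0 i) (sub_nonneg.2 (hle i)))).1 h3
  obtain ⟨i, hi⟩ : ∃ i, a i ≠ 0 := by
    by_contra! h
    simp [h] at h1
  have hi1 : a i = 1 := by
    have := (mul_eq_zero.1 (h4 i (Finset.mem_univ i))).resolve_left hi
    linarith
  refine ⟨i, hi1, fun j hj => ?_⟩
  rw [← Finset.add_sum_erase _ _ (Finset.mem_univ i), hi1, add_eq_left] at h1
  exact (Finset.sum_eq_zero_iff_of_nonneg (fun j _ => h0 j)).1 h1 j (by simp [hj])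

variable {N : ℕ}

theorem pauliString_eq_pauliOp (s : Fin N → Fin 4) : pauliString s = pauliOp s := rfl

theorem tensor_eq_kronAlong (A : Finset (Fin N)) : tensor A = kronAlong (split A) := rfl

theorem linOpStabEntropy_eq_zero_iff {O : Op (Fin N)}
    (hO : O ∈ Matrix.unitaryGroup (Fin N → Fin 2) ℂ) :
    linOpStabEntropy O = 0 ↔ ∃ (c : ℂ) (s : Fin N → Fin 4), O = c • pauliString s := by
  have hd : ((2 : ℝ) ^ N) ≠ 0 := pow_ne_zero _ two_ne_zero
  constructor
  · intro h
    have h1 := sum_norm_trace_sq O hO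
    rw [Fintype.card_fin] at h1
    obtain ⟨s, -, hs⟩ := exists_eq_one_of_sum_sq_eq_one
      (a := fun s => (((2 : ℝ) ^ N)⁻¹ * ‖(O * pauliOp s).trace‖) ^ 2) (fun s => by positivity)
      (by simp only [mul_pow, ← Finset.mul_sum, h1]; field_simp)
      (by
        simp only [← pow_mul, mul_pow, ← Finset.mul_sum]
        exact (sub_eq_zero.1 h).symm)
    refine ⟨(2 ^ Fintype.card (Fin N) : ℂ)⁻¹ * (O * pauliOp s).trace, s, ?_⟩
    conv_lhs => rw [eq_sum_trace_smul_pauliOp O]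
    rw [Finset.sum_eq_single s _ (by simp), smul_smul, pauliString_eq_pauliOp]
    intro t _ ht
    have := hs t ht
    simp only [pow_eq_zero_iff two_ne_zero, mul_eq_zero, inv_eq_zero, hd, norm_eq_zero,
      false_or] at this
    rw [this, zero_smul]
  · rintro ⟨c, s, rfl⟩
    have hc : ‖c‖ = 1 := norm_eq_one_of_smul_mem_unitaryGroup (pauliOp_mem_unitaryGroup s) hO
    rw [linOpStabEntropy, Finset.sum_eq_single s]
    · rw [pauliString_eq_pauliOp, Matrix.smul_mul, Matrix.trace_smul, trace_pauliOp_mul,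
        if_pos rfl, smul_eq_mul, norm_mul, hc, one_mul, norm_pow, Complex.norm_two,
        Fintype.card_fin, ← mul_pow, inv_mul_cancel₀ hd, one_pow, sub_self]
    · intro t _ ht
      rw [pauliString_eq_pauliOp, pauliString_eq_pauliOp, Matrix.smul_mul, Matrix.trace_smul,
        trace_pauliOp_mul, if_neg ht.symm]
      simp
    · simp

open scoped ComplexOrder in
theorem schmidtCoeff_nonneg (A : Finset (Fin N)) (O : Op (Fin N)) (i) :
    0 ≤ schmidtCoeff A O i :=
  (Matrix.posSemidef_self_mul_conjTranspose (realign A O)).eigenvalues_nonneg i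

theorem sum_schmidtCoeff (A : Finset (Fin N)) {O : Op (Fin N)}
    (hO : O ∈ Matrix.unitaryGroup (Fin N → Fin 2) ℂ) : ∑ i, schmidtCoeff A O i = 1 := by
  have h1 := (Matrix.isHermitian_mul_conjTranspose_self (realign A O)).trace_eq_sum_eigenvalues
  have h2 : (O * Oᴴ).trace = 2 ^ N := by
    have : O * Oᴴ = 1 := Matrix.mem_unitaryGroup_iff.1 hO
    rw [this, Matrix.trace_one]
    simp
  have h3 : (realign A O * (realign A O)ᴴ).trace = (2 ^ N : ℂ)⁻¹ * (O * Oᴴ).trace := by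
    have hs : ((Real.sqrt (2 ^ N))⁻¹ : ℂ) * ((Real.sqrt (2 ^ N))⁻¹ : ℂ) = (2 ^ N : ℂ)⁻¹ := by
      rw [← mul_inv, ← Complex.ofReal_mul, Real.mul_self_sqrt (by positivity)]
      push_cast
      rfl
    have h5 : (O * Oᴴ).trace = ∑ a : (Inside A → Fin 2) × (Inside A → Fin 2),
        ∑ b : (Outside A → Fin 2) × (Outside A → Fin 2),
        O ((split A).symm (a.1, b.1)) ((split A).symm (a.2, b.2)) *
          star (O ((split A).symm (a.1, b.1)) ((split A).symm (a.2, b.2))) := by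
      simp only [Matrix.trace, Matrix.diag, Matrix.mul_apply, Matrix.conjTranspose_apply]
      rw [← (split A).symm.sum_comp]
      simp_rw [fun x => ((split A).symm.sum_comp (fun y => O x y * star (O x y))).symm]
      simp only [Fintype.sum_prod_type]
      exact Finset.sum_congr rfl fun a _ => Finset.sum_comm
    rw [h5, Finset.mul_sum]
    refine Finset.sum_congr rfl fun a _ => ?_
    rw [Matrix.diag_apply, Matrix.mul_apply, Finset.mul_sum]
    refine Finset.sum_congr rfl fun b _ => ?_
    rw [← hs]
    simp only [realign, Matrix.of_apply, Matrix.conjTranspose_apply, star_mul', star_inv₀,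
      Complex.star_def, Complex.conj_ofReal]
    ring
  have h4 : ((∑ i, schmidtCoeff A O i : ℝ) : ℂ) = 1 := by
    rw [h2, inv_mul_cancel₀ (pow_ne_zero _ two_ne_zero)] at h3
    rw [← h3, h1]
    push_cast
    rfl
  exact_mod_cast h4

theorem linOpEntanglement_nonneg (A : Finset (Fin N)) {O : Op (Fin N)}
    (hO : O ∈ Matrix.unitaryGroup (Fin N → Fin 2) ℂ) : 0 ≤ linOpEntanglement A O := by
  have h1 := Finset.sum_sq_le_sq_sum_of_nonneg (s := Finset.univ)
    (f := schmidtCoeff A O) fun i _ => schmidtCoeff_nonneg A O i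
  rw [sum_schmidtCoeff A hO, one_pow] at h1
  exact sub_nonneg.2 h1

theorem exists_tensor_of_linOpEntanglement_eq_zero (A : Finset (Fin N)) {O : Op (Fin N)}
    (hO : O ∈ Matrix.unitaryGroup (Fin N → Fin 2) ℂ) (h : linOpEntanglement A O = 0) :
    ∃ g ∈ Matrix.unitaryGroup (Inside A → Fin 2) ℂ,
      ∃ k ∈ Matrix.unitaryGroup (Outside A → Fin 2) ℂ, O = tensor A g k := by
  obtain ⟨i, hi, hj⟩ := exists_eq_one_of_sum_sq_eq_one (schmidtCoeff_nonneg A O)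
    (sum_schmidtCoeff A hO) (sub_eq_zero.1 h).symm
  obtain ⟨V, W, hVW⟩ := exists_isOperatorSchmidt A O
  have hd := hVW.decomp
  have hpos : 0 < schmidtCoeff A O i := hi ▸ one_pos
  rw [Finset.sum_eq_single ⟨i, hpos⟩ (fun b _ hb => by
      have := b.2
      rw [hj b.1 fun h => hb (Subtype.ext h)] at this
      exact absurd this (lt_irrefl _)) (by simp),
    show Real.sqrt (schmidtCoeff A O i) = 1 by rw [hi, Real.sqrt_one],
    Complex.ofReal_one, one_smul, inv_smul_eq_iff₀ (by simp), tensor_eq_kronAlong,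
    ← kronAlong_smul_left] at hd
  rw [hd] at hO ⊢
  exact exists_unitary_factors (split A) hO

theorem linOpEntanglement_tensor (A : Finset (Fin N)) {g : Op (Inside A)} {k : Op (Outside A)}
    (hg : g ∈ Matrix.unitaryGroup (Inside A → Fin 2) ℂ)
    (hk : k ∈ Matrix.unitaryGroup (Outside A → Fin 2) ℂ) :
    linOpEntanglement A (tensor A g k) = 0 := by
  have hnorm : ∀ {n : Type} [Fintype n] [DecidableEq n] [Nonempty n] {g : Matrix n n ℂ},
      g ∈ Matrix.unitaryGroup n ℂ →
      ((((Real.sqrt (Fintype.card n))⁻¹ : ℝ) : ℂ) • g)ᴴ *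
        ((((Real.sqrt (Fintype.card n))⁻¹ : ℝ) : ℂ) • g) =
      (Fintype.card n : ℂ)⁻¹ • (1 : Matrix n n ℂ) := by
    intro n _ _ _ g hg
    have hg' : gᴴ * g = 1 := Matrix.mem_unitaryGroup_iff'.1 hg
    rw [Matrix.conjTranspose_smul, Matrix.smul_mul, Matrix.mul_smul, hg', smul_smul,
      Complex.star_def, Complex.conj_ofReal, ← Complex.ofReal_mul, ← mul_inv,
      Real.mul_self_sqrt (by positivity)]
    simp
  have hcard : Fintype.card (Inside A → Fin 2) * Fintype.card (Outside A → Fin 2) = 2 ^ N := by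
    rw [← Fintype.card_prod, ← Fintype.card_congr (split A)]
    simp
  have hs : IsOperatorSchmidt A (tensor A g k) (fun _ : Unit => 1)
      (fun _ => (((Real.sqrt (Fintype.card (Inside A → Fin 2)))⁻¹ : ℝ) : ℂ) • g)
      (fun _ => (((Real.sqrt (Fintype.card (Outside A → Fin 2)))⁻¹ : ℝ) : ℂ) • k) := by
    refine ⟨fun _ => one_pos, fun i j => ?_, fun i j => ?_, ?_⟩
    · rw [hnorm hg, Matrix.trace_smul, Matrix.trace_one, smul_eq_mul, inv_mul_cancel₀, if_pos rfl]
      exact Nat.cast_ne_zero.2 Fintype.card_ne_zero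
    · rw [hnorm hk, Matrix.trace_smul, Matrix.trace_one, smul_eq_mul, inv_mul_cancel₀, if_pos rfl]
      exact Nat.cast_ne_zero.2 Fintype.card_ne_zero
    · rw [Fintype.sum_unique, Real.sqrt_one, Complex.ofReal_one, one_smul, tensor_eq_kronAlong,
        kronAlong_smul_left, kronAlong_smul_right, smul_smul, ← Complex.ofReal_mul, ← mul_inv,
        ← Real.sqrt_mul (by positivity), ← Nat.cast_mul, hcard]
      push_cast
      rfl
  rw [linOpEntanglement_eq A _ hs]
  simp

theorem tensor_pauliOp (A : Finset (Fin N)) (s : Inside A → Fin 4) (t : Outside A → Fin 4) :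
    tensor A (pauliOp s) (pauliOp t) =
      pauliString fun i => if h : i ∈ A then s ⟨i, h⟩ else t ⟨i, h⟩ := by
  ext x y
  rw [pauliString, Matrix.of_apply, ← Fintype.prod_subtype_mul_prod_subtype (fun i => i ∈ A)]
  simp only [tensor_eq_kronAlong, kronAlong_apply, pauliOp, productOp, Matrix.of_apply]
  congr 1
  · refine Finset.prod_congr (by ext; simp) fun i _ => ?_
    simp [split, i.2]
  · refine Finset.prod_congr (by ext; simp) fun i _ => ?_
    simp [split, i.2]

theorem pauliString_eq_tensor (A : Finset (Fin N)) (s : Fin N → Fin 4) :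
    pauliString s = tensor A (pauliOp fun i => s i) (pauliOp fun i => s i) := by
  rw [tensor_pauliOp]
  simp

/-- The conjugates of the Pauli strings by a unitary, with phases, form a Pauli-like set. -/
theorem isPauliLike_conj {U : Op (Fin N)} (hU : U ∈ Matrix.unitaryGroup (Fin N → Fin 2) ℂ) :
    IsPauliLike {x : Op (Fin N) |
      ∃ (c : ℂ) (s : Fin N → Fin 4), ‖c‖ = 1 ∧ x = c • (Uᴴ * pauliString s * U)} := by
  have hU1 : U * Uᴴ = 1 := Matrix.mem_unitaryGroup_iff.1 hU
  have hU2 : Uᴴ * U = 1 := Matrix.mem_unitaryGroup_iff'.1 hU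
  have hmul : ∀ X Y : Op (Fin N), Uᴴ * X * U * (Uᴴ * Y * U) = Uᴴ * (X * Y) * U := fun X Y => by
    calc _ = Uᴴ * X * (U * Uᴴ) * Y * U := by simp only [Matrix.mul_assoc]
      _ = _ := by rw [hU1]; simp only [Matrix.mul_assoc, Matrix.one_mul]
  constructor
  · rintro _ ⟨c, s, hc, rfl⟩
    have h : c • (1 : Op (Fin N)) ∈ Matrix.unitaryGroup (Fin N → Fin 2) ℂ := by
      rw [Matrix.mem_unitaryGroup_iff, Matrix.star_eq_conjTranspose, Matrix.conjTranspose_smul,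
        Matrix.conjTranspose_one, Matrix.smul_mul, Matrix.one_mul, smul_smul, Complex.star_def,
        Complex.mul_conj', hc]
      simp
    have h2 := mul_mem h (mul_mem (mul_mem (Unitary.star_mem hU) (pauliOp_mem_unitaryGroup s)) hU)
    rwa [Matrix.smul_mul, Matrix.one_mul] at h2
  · rintro _ ⟨c, s, hc, rfl⟩ _ ⟨c', s', hc', rfl⟩
    obtain ⟨a, t, ha, h⟩ := exists_pauliOp_mul s s'
    refine ⟨c * c' * a, t, by rw [norm_mul, norm_mul, hc, hc', ha, one_mul, one_mul], ?_⟩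
    rw [Matrix.smul_mul, Matrix.mul_smul, hmul, pauliString_eq_pauliOp, pauliString_eq_pauliOp, h,
      Matrix.mul_smul, Matrix.smul_mul, smul_smul, smul_smul, pauliString_eq_pauliOp]
  · rintro a ha _ ⟨c, s, hc, rfl⟩
    exact ⟨a * c, s, by rw [norm_mul, ha, hc, one_mul], by rw [smul_smul]⟩
  · rintro _ ⟨c, s, hc, rfl⟩
    refine ⟨c * c, ?_⟩
    rw [Matrix.smul_mul, Matrix.mul_smul, hmul, pauliString_eq_pauliOp, pauliOp_mul_self,
      Matrix.mul_one, hU2, smul_smul]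
  · refine eq_top_iff.2 fun Y _ => ?_
    have h1 : ∀ X : Op (Fin N), Uᴴ * X * U ∈ Submodule.span ℂ {x : Op (Fin N) |
        ∃ (c : ℂ) (s : Fin N → Fin 4), ‖c‖ = 1 ∧ x = c • (Uᴴ * pauliString s * U)} := by
      intro X
      have hX : X ∈ Submodule.span ℂ (Set.range (pauliOp : (Fin N → Fin 4) → Op (Fin N))) :=
        by rw [span_range_pauliOp]; exact Submodule.mem_top
      induction hX using Submodule.span_induction with
      | mem x hx =>
        obtain ⟨s, rfl⟩ := hx
        exact Submodule.subset_span ⟨1, s, by simp, by rw [one_smul]; rfl⟩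
      | zero => simp
      | add x y _ _ hx hy =>
        rw [Matrix.mul_add, Matrix.add_mul]
        exact Submodule.add_mem _ hx hy
      | smul c x _ hx =>
        rw [Matrix.mul_smul, Matrix.smul_mul]
        exact Submodule.smul_mem _ c hx
    have h2 := h1 (U * Y * Uᴴ)
    have h3 : Uᴴ * (U * Y * Uᴴ) * U = (Uᴴ * U) * Y * (Uᴴ * U) := by simp only [Matrix.mul_assoc]
    rwa [h3, hU2, Matrix.one_mul, Matrix.mul_one] at h2

theorem conj_pauliString_mem_unitaryGroup {U : Op (Fin N)}
    (hU : U ∈ Matrix.unitaryGroup (Fin N → Fin 2) ℂ) (s : Fin N → Fin 4) :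
    Uᴴ * pauliString s * U ∈ Matrix.unitaryGroup (Fin N → Fin 2) ℂ :=
  (isPauliLike_conj hU).unitary _ ⟨1, s, by simp, by rw [one_smul]⟩

theorem pauliEntanglingPower_eq_zero_iff (A : Finset (Fin N)) {U : Op (Fin N)}
    (hU : U ∈ Matrix.unitaryGroup (Fin N → Fin 2) ℂ) :
    pauliEntanglingPower A U = 0 ↔
      ∀ s, linOpEntanglement A (Uᴴ * pauliString s * U) = 0 := by
  have h4 : ((4 : ℝ) ^ N)⁻¹ ≠ 0 := inv_ne_zero (pow_ne_zero _ (by norm_num))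
  rw [pauliEntanglingPower, mul_eq_zero, or_iff_right h4, Finset.sum_eq_zero_iff_of_nonneg
    fun s _ => linOpEntanglement_nonneg A (conj_pauliString_mem_unitaryGroup hU s)]
  simp

/-- The Pauli-entangling power vanishes iff a product of local unitaries turns `U` into a Clifford
unitary. -/
theorem pauliEntanglingPower_eq_zero_iff_exists_local (A : Finset (Fin N)) {U : Op (Fin N)}
    (hU : U ∈ Matrix.unitaryGroup (Fin N → Fin 2) ℂ) :
    pauliEntanglingPower A U = 0 ↔
      ∃ V ∈ Matrix.unitaryGroup (Inside A → Fin 2) ℂ,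
      ∃ W ∈ Matrix.unitaryGroup (Outside A → Fin 2) ℂ,
        ∀ s : Fin N → Fin 4,
          linOpStabEntropy
            (tensor A Vᴴ Wᴴ * (Uᴴ * pauliString s * U) *
              tensor A V W) = 0 := by
  rw [pauliEntanglingPower_eq_zero_iff A hU]
  have hconj : ∀ {V : Op (Inside A)} {W : Op (Outside A)},
      V ∈ Matrix.unitaryGroup (Inside A → Fin 2) ℂ →
      W ∈ Matrix.unitaryGroup (Outside A → Fin 2) ℂ → ∀ s,
      tensor A Vᴴ Wᴴ * (Uᴴ * pauliString s * U) * tensor A V W ∈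
        Matrix.unitaryGroup (Fin N → Fin 2) ℂ := fun hV hW s =>
    mul_mem (mul_mem (kronAlong_mem_unitaryGroup _ (Unitary.star_mem hV) (Unitary.star_mem hW))
      (conj_pauliString_mem_unitaryGroup hU s)) (kronAlong_mem_unitaryGroup _ hV hW)
  constructor
  · intro h
    have hprod := fun s => exists_tensor_of_linOpEntanglement_eq_zero A
      (conj_pauliString_mem_unitaryGroup hU s) (h s)
    have hprod' : ∀ x ∈ {x : Op (Fin N) |
        ∃ (c : ℂ) (s : Fin N → Fin 4), ‖c‖ = 1 ∧ x = c • (Uᴴ * pauliString s * U)},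
        ∃ g ∈ Matrix.unitaryGroup (Inside A → Fin 2) ℂ,
        ∃ k ∈ Matrix.unitaryGroup (Outside A → Fin 2) ℂ, x = kronAlong (split A) g k := by
      intro x hx
      have hxu := (isPauliLike_conj hU).unitary x hx
      obtain ⟨c, s, -, rfl⟩ := hx
      obtain ⟨g, -, k, -, hgk⟩ := hprod s
      rw [hgk, tensor_eq_kronAlong, ← kronAlong_smul_left] at hxu ⊢
      exact exists_unitary_factors _ hxu
    obtain ⟨V, hV, hVg⟩ := ((isPauliLike_conj hU).factor (split A) hprod').exists_unitary
    obtain ⟨W, hW, hWk⟩ := ((isPauliLike_conj hU).factor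
      ((split A).trans (Equiv.prodComm _ _)) fun x hx => by
        obtain ⟨g, hg, k, hk, rfl⟩ := hprod' x hx
        exact ⟨k, hk, g, hg, (kronAlong_swap _ _ _).symm⟩).exists_unitary
    refine ⟨V, hV, W, hW, fun s => (linOpStabEntropy_eq_zero_iff (hconj hV hW s)).2 ?_⟩
    obtain ⟨g, hg, k, hk, hgk⟩ := hprod s
    have hmem : kronAlong (split A) g k ∈ {x : Op (Fin N) |
        ∃ (c : ℂ) (s : Fin N → Fin 4), ‖c‖ = 1 ∧ x = c • (Uᴴ * pauliString s * U)} :=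
      ⟨1, s, by simp, by rw [one_smul, hgk]; rfl⟩
    obtain ⟨a, t, hat⟩ := hVg g ⟨hg, k, hk, hmem⟩
    obtain ⟨b, t', hbt⟩ := hWk k ⟨hk, g, hg, by rw [kronAlong_swap]; exact hmem⟩
    rw [hgk, tensor_eq_kronAlong, kronAlong_mul, kronAlong_mul, hat, hbt, kronAlong_smul_left,
      kronAlong_smul_right, smul_smul, ← tensor_eq_kronAlong, tensor_pauliOp]
    exact ⟨_, _, rfl⟩
  · rintro ⟨V, hV, W, hW, h⟩ s
    obtain ⟨c, t, hct⟩ := (linOpStabEntropy_eq_zero_iff (hconj hV hW s)).1 (h s)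
    have hT := kronAlong_mem_unitaryGroup (split A) hV hW
    have hT1 : tensor A V W * tensor A Vᴴ Wᴴ = 1 := by
      rw [tensor_eq_kronAlong, ← conjTranspose_kronAlong]
      exact Matrix.mem_unitaryGroup_iff.1 hT
    have hO : Uᴴ * pauliString s * U = tensor A (c • (V * pauliOp (fun i : Inside A => t i) * Vᴴ))
        (W * pauliOp (fun i : Outside A => t i) * Wᴴ) := by
      calc Uᴴ * pauliString s * U
          = (tensor A V W * tensor A Vᴴ Wᴴ) * (Uᴴ * pauliString s * U) *
            (tensor A V W * tensor A Vᴴ Wᴴ) := by rw [hT1, Matrix.one_mul, Matrix.mul_one]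
        _ = tensor A V W * (c • pauliString t) * tensor A Vᴴ Wᴴ := by
            rw [← hct]; simp only [Matrix.mul_assoc]
        _ = _ := by
            rw [pauliString_eq_tensor A t, tensor_eq_kronAlong, Matrix.mul_smul, Matrix.smul_mul,
              kronAlong_mul, kronAlong_mul, kronAlong_smul_left]
    have hOu := conj_pauliString_mem_unitaryGroup hU s
    rw [hO] at hOu ⊢
    obtain ⟨g, hg, k, hk, hgk⟩ := exists_unitary_factors (split A) hOu
    rw [tensor_eq_kronAlong, hgk]
    exact linOpEntanglement_tensor A hg hk

end Entropies

end PauliEntangling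

end

theorem corollary1 (N : ℕ) (A : Finset (Fin N))
    (U : PauliEntangling.Op (Fin N)) (hU : U ∈ Matrix.unitaryGroup (Fin N → Fin 2) ℂ) :
    PauliEntangling.pauliEntanglingPower A U = 0 ↔
      ∃ V ∈ Matrix.unitaryGroup (PauliEntangling.Inside A → Fin 2) ℂ,
      ∃ W ∈ Matrix.unitaryGroup (PauliEntangling.Outside A → Fin 2) ℂ,
        ∀ s : Fin N → Fin 4,
          PauliEntangling.linOpStabEntropy
            (PauliEntangling.tensor A Vᴴ Wᴴ * (Uᴴ * PauliEntangling.pauliString s * U) *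
              PauliEntangling.tensor A V W) = 0 :=
  PauliEntangling.pauliEntanglingPower_eq_zero_iff_exists_local A hU
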